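/- Let $I$ be a finite set of $N$ options. A *Llull matrix* is a family of real numbers $(v_{xy})$, indexed by the ordered pairs of different options $x,y\in I$, such that $v_{xy}\ge 0$ and $v_{xy}+v_{yx}\le 1$. Its turnouts are $t_{xy}=v_{xy}+v_{yx}$. *Indirect comparison relation.* The indirect score $v^*_{xy}$ ($x\ne y$) is the maximum, over all paths $x=x_0,x_1,\dots,x_n=y$ (with $x_i\neq x_{i+1}$), of $\min_{0\le i<n} v_{x_ix_{i+1}}$. The indirect margins are $m^*_{xy}=v^*_{xy}-v^*_{yx}$, and $\nu=\{xy\mid m^*_{xy}>0\}$. An *admissible order* is a total (strict) order $\xi$ on $I$ with $\nu\subseteq\xi$; such orders exist. For an admissible order $\xi$, let $x'$ denote the immediate successor of $x$ in $\xi$. *Rank-like rates.* Given an admissible order $\xi$, put $m^\sigma_{xy}=\min\{m^*_{pq}\mid p \text{ equal to or before } x,\ q \text{ equal to or after } y \text{ in } \xi\}$ for $x$ before $y$. Let $(t^\sigma_{xy})$ be the minimizer of $\sum_x\sum_{y\ne x}(\tau_{xy}-t_{xy})^2$ over the matrices $(\tau_{xy})_{x\ne y}$ that satisfy $\tau_{xy}=\tau_{yx}$;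 $\ m^\sigma_{xx'}\le\tau_{xx'}\le 1$; $\ 0\le\tau_{xz}-\tau_{x'z}\le m^\sigma_{xx'}$ whenever $z\notin\{x,x'\}$. Let $\gamma_{xx'}=[(t^\sigma_{xx'}-m^\sigma_{xx'})/2,\ (t^\sigma_{xx'}+m^\sigma_{xx'})/2]$ and, for $x$ before $y$ in $\xi$, let $\gamma_{xy}$ be the union of the intervals $\gamma_{pp'}$ with $p$ equal to or after $x$ and before $y$. The projected scores are $v^\pi_{xy}=\max\gamma_{xy}$ and $v^\pi_{yx}=\min\gamma_{xy}$ for $x$ before $y$, and the rank-like rates are $R_x=N-\sum_{y\ne x}v^\pi_{xy}$. They determine the total preorder $\hat R=\{xy\mid x\neq y,\ R_x\le R_y\}$. *Autonomous sets and contraction.* A subset $C\subseteq I$ is autonomous for the Llull matrix if $v_{ax}=v_{bx}$ and $v_{xa}=v_{xb}$ for all $a,b\in C$, $x\notin C$. It is autonomous for a relation $\rho$ if, for all $x\notin C$ and $a,b\in C$, $ax\in\rho$ implies $bx\in\rho$, and $xa\in\rho$ implies $xb\in\rho$. If $C$ is nonempty and autonomous, contracting $C$ means replacing all of its elements by a single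 option $\tilde c$, which relates to the options outside $C$ as any element of $C$ does. **Theorem (clone consistency).** Assume that $C\subseteq I$ is autonomous for the Llull matrix $(v_{xy})$. Then $C$ is autonomous for $\nu$ and, whatever admissible order is used to compute the rank-like rates, for the total preorder $\hat R$. Besides, if $C$ is nonempty, then the relations $\nu$ and $\hat R$ obtained from the contracted Llull matrix (on $(I\setminus C)\cup\{\tilde c\}$) are exactly the contractions of the relations $\nu$ and $\hat R$ obtained from $(v_{xy})$, whatever admissible orders are used in the two computations of $\hat R$. -/

import Mathlib

namespace CLC

/-- A (relative) Llull matrix on the set of options `I`. Only the entries `score x y` with `x ≠ y`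
are meaningful; the diagonal entries are never used. -/
structure LlullMatrix (I : Type*) where
  score : I → I → ℝ
  score_nonneg : ∀ x y, x ≠ y → 0 ≤ score x y
  turnout_le_one : ∀ x y, x ≠ y → score x y + score y x ≤ 1

section Basic

variable {I : Type*}

/-- The turnouts `t x y = v x y + v y x`. -/
def LlullMatrix.turnout (v : LlullMatrix I) (x y : I) : ℝ := v.score x y + v.score y x

/-- `p 0, p 1, …, p n` is a path from `x` to `y` with `n ≥ 1` links, each joining two
different options. -/
def IsPath (n : ℕ) (p : ℕ → I) (x y : I) : Prop :=
  p 0 = x ∧ p n = y ∧ ∀ i < n, p i ≠ p (i + 1)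

/-- The score of the path `p 0, p 1, …, p (n + 1)`: the minimum of the scores of its links. -/
noncomputable def LlullMatrix.pathScore (v : LlullMatrix I) (n : ℕ) (p : ℕ → I) : ℝ :=
  (Finset.range (n + 1)).inf' Finset.nonempty_range_add_one (fun i => v.score (p i) (p (i + 1)))

/-- The indirect scores: the maximum of the scores of the paths from `x` to `y`
(these scores take finitely many values when `I` is finite, so the supremum is a maximum). -/
noncomputable def LlullMatrix.indirectScore (v : LlullMatrix I) (x y : I) : ℝ :=
  sSup {s | ∃ (n : ℕ) (p : ℕ → I), IsPath (n + 1) p x y ∧ s = v.pathScore n p}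

/-- The indirect margins. -/
noncomputable def LlullMatrix.indirectMargin (v : LlullMatrix I) (x y : I) : ℝ :=
  v.indirectScore x y - v.indirectScore y x

/-- The indirect comparison relation `ν`. -/
def LlullMatrix.indirectComparison (v : LlullMatrix I) (x y : I) : Prop :=
  0 < v.indirectMargin x y

/-- An admissible order: a (strict) total order that extends the indirect comparison relation.
`lt x y` means that `x` is placed before `y`. -/
structure AdmissibleOrder (v : LlullMatrix I) where
  lt : I → I → Prop
  isStrictTotalOrder : IsStrictTotalOrder I lt
  extends_comparison : ∀ x y, v.indirectComparison x y → lt x y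

/-- The reflexive form of an admissible order. -/
def AdmissibleOrder.le {v : LlullMatrix I} (ξ : AdmissibleOrder v) (x y : I) : Prop :=
  x = y ∨ ξ.lt x y

/-- `y` is the immediate successor of `x`. -/
def AdmissibleOrder.IsSucc {v : LlullMatrix I} (ξ : AdmissibleOrder v) (x y : I) : Prop :=
  ξ.lt x y ∧ ∀ z, ¬ (ξ.lt x z ∧ ξ.lt z y)

theorem score_le_one (v : LlullMatrix I) {x y : I} (h : x ≠ y) : v.score x y ≤ 1 := by
  have h1 := v.turnout_le_one x y h
  have h2 := v.score_nonneg y x h.symm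
  linarith

theorem pathScore_mem (v : LlullMatrix I) {n : ℕ} {p : ℕ → I} {x y : I}
    (h : IsPath (n + 1) p x y) : v.pathScore n p ∈ Set.Icc (0 : ℝ) 1 := by
  constructor
  · refine Finset.le_inf' _ _ fun i hi => ?_
    exact v.score_nonneg _ _ (h.2.2 i (Finset.mem_range.1 hi))
  · refine (Finset.inf'_le _ (Finset.mem_range.2 (Nat.succ_pos n))).trans ?_
    exact score_le_one v (h.2.2 0 (Nat.succ_pos n))

theorem indirectScore_mem (v : LlullMatrix I) (x y : I) :
    v.indirectScore x y ∈ Set.Icc (0 : ℝ) 1 := by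
  constructor
  · refine Real.sSup_nonneg ?_
    rintro s ⟨n, p, hp, rfl⟩
    exact (pathScore_mem v hp).1
  · refine Real.sSup_le ?_ zero_le_one
    rintro s ⟨n, p, hp, rfl⟩
    exact (pathScore_mem v hp).2

theorem indirectMargin_le_one (v : LlullMatrix I) (x y : I) : v.indirectMargin x y ≤ 1 := by
  have h1 := (indirectScore_mem v x y).2
  have h2 := (indirectScore_mem v y x).1
  unfold LlullMatrix.indirectMargin
  linarith

theorem indirectMargin_nonneg {v : LlullMatrix I} (ξ : AdmissibleOrder v) {x y : I}
    (h : ξ.lt x y) : 0 ≤ v.indirectMargin x y := by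
  have := ξ.isStrictTotalOrder
  by_contra hneg
  have h' : ξ.lt y x := ξ.extends_comparison y x (by
    unfold LlullMatrix.indirectComparison
    unfold LlullMatrix.indirectMargin at hneg ⊢
    linarith)
  exact irrefl_of ξ.lt x (trans_of ξ.lt h h')

end Basic

section Method

variable {I : Type*} [Fintype I] [DecidableEq I]

open Classical in
/-- The intermediate projected margins
`min {indirectMargin p q | p weakly before x, y weakly before q}`. -/
noncomputable def interMargin {v : LlullMatrix I} (ξ : AdmissibleOrder v) (x y : I) : ℝ :=
  ((Finset.univ : Finset (I × I)).filter (fun pq => ξ.le pq.1 x ∧ ξ.le y pq.2)).inf'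
    ⟨(x, y), Finset.mem_filter.2 ⟨Finset.mem_univ _, Or.inl rfl, Or.inl rfl⟩⟩ (fun pq => v.indirectMargin pq.1 pq.2)

/-- The set of matrices over which the distance to the turnouts is minimized. A matrix indexed by
the pairs of different options is encoded by setting its diagonal to `0`. -/
def feasible {v : LlullMatrix I} (ξ : AdmissibleOrder v) : Set (I → I → ℝ) :=
  {τ | (∀ x, τ x x = 0) ∧ (∀ x y, τ x y = τ y x) ∧
    (∀ x x', ξ.IsSucc x x' → interMargin ξ x x' ≤ τ x x' ∧ τ x x' ≤ 1) ∧
    (∀ x x' z, ξ.IsSucc x x' → z ≠ x → z ≠ x' →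
      0 ≤ τ x z - τ x' z ∧ τ x z - τ x' z ≤ interMargin ξ x x')}

/-- The quantity to be minimized. -/
def phi (v : LlullMatrix I) (τ : I → I → ℝ) : ℝ :=
  ∑ x, ∑ y ∈ Finset.univ.erase x, (τ x y - v.turnout x y) ^ 2


/-! Well-definedness of the method: bounds on the indirect scores, existence of the minimizer of
`phi` and existence of admissible orders. -/

theorem interMargin_le_one {v : LlullMatrix I} (ξ : AdmissibleOrder v) (x y : I) :
    interMargin ξ x y ≤ 1 := by
  classical
  refine (Finset.inf'_le (b := (x, y)) _
    (Finset.mem_filter.2 ⟨Finset.mem_univ _, Or.inl rfl, Or.inl rfl⟩)).trans ?_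
  exact indirectMargin_le_one v x y

theorem interMargin_nonneg {v : LlullMatrix I} (ξ : AdmissibleOrder v) {x y : I}
    (h : ξ.lt x y) : 0 ≤ interMargin ξ x y := by
  classical
  have := ξ.isStrictTotalOrder
  refine Finset.le_inf' _ _ fun pq hpq => ?_
  obtain ⟨-, h1, h2⟩ := Finset.mem_filter.1 hpq
  apply indirectMargin_nonneg ξ
  have h3 : ξ.lt pq.1 y := by
    rcases h1 with h1 | h1
    · rwa [h1]
    · exact trans_of ξ.lt h1 h
  rcases h2 with h2 | h2
  · rwa [← h2]
  · exact trans_of ξ.lt h3 h2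

theorem feasible_nonempty {v : LlullMatrix I} (ξ : AdmissibleOrder v) :
    (feasible ξ).Nonempty := by
  have := ξ.isStrictTotalOrder
  refine ⟨fun x y => if x = y then 0 else 1, by simp, by simp [eq_comm], ?_, ?_⟩
  · intro x x' h
    have hne : x ≠ x' := by
      rintro rfl
      exact irrefl_of ξ.lt x h.1
    simp [hne, interMargin_le_one]
  · intro x x' z h hz hz'
    simp [hz.symm, hz'.symm, interMargin_nonneg ξ h.1]

theorem feasible_isClosed {v : LlullMatrix I} (ξ : AdmissibleOrder v) :
    IsClosed (feasible ξ) := by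
  have hc : ∀ x y : I, Continuous fun τ : I → I → ℝ => τ x y := fun x y => by fun_prop
  simp only [feasible, Set.ofPred_and, Set.ofPred_forall]
  refine ((isClosed_iInter fun x => isClosed_eq (hc _ _) continuous_const).inter
    ((isClosed_iInter fun x => isClosed_iInter fun y => isClosed_eq (hc _ _) (hc _ _)).inter
    ((isClosed_iInter fun x => isClosed_iInter fun x' => isClosed_iInter fun _ =>
      (isClosed_le continuous_const (hc _ _)).inter (isClosed_le (hc _ _) continuous_const)).inter
    (isClosed_iInter fun x => isClosed_iInter fun x' => isClosed_iInter fun z =>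
      isClosed_iInter fun _ => isClosed_iInter fun _ => isClosed_iInter fun _ =>
      (isClosed_le continuous_const ((hc _ _).sub (hc _ _))).inter
        (isClosed_le ((hc _ _).sub (hc _ _)) continuous_const)))))

theorem exists_minimizer {v : LlullMatrix I} (ξ : AdmissibleOrder v) :
    ∃ τ ∈ feasible ξ, ∀ τ' ∈ feasible ξ, phi v τ ≤ phi v τ' := by
  obtain ⟨τ₀, h₀⟩ := feasible_nonempty ξ
  have hcont : Continuous (phi v) := by
    unfold phi
    fun_prop
  have hcompact : IsCompact (feasible ξ ∩ {τ | phi v τ ≤ phi v τ₀}) := by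
    refine IsCompact.of_isClosed_subset (isCompact_univ_pi fun x => isCompact_univ_pi fun y =>
      isCompact_Icc (a := -(|v.turnout x y| + phi v τ₀ + 1)) (b := |v.turnout x y| + phi v τ₀ + 1))
      ((feasible_isClosed ξ).inter (isClosed_le hcont continuous_const)) ?_
    rintro τ ⟨hτ, hle⟩ x - y -
    have hpos : ∀ σ : I → I → ℝ, 0 ≤ phi v σ := fun σ =>
      Finset.sum_nonneg fun x _ => Finset.sum_nonneg fun y _ => sq_nonneg _
    have h0 := hpos τ₀
    refine abs_le.1 ?_
    by_cases hxy : y = x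
    · subst hxy
      rw [hτ.1 y, abs_zero]
      positivity
    · have h1 : (τ x y - v.turnout x y) ^ 2 ≤ phi v τ := by
        refine le_trans ?_ (Finset.single_le_sum (f := fun x =>
          ∑ y ∈ Finset.univ.erase x, (τ x y - v.turnout x y) ^ 2)
          (fun x _ => Finset.sum_nonneg fun y _ => sq_nonneg _) (Finset.mem_univ x))
        exact Finset.single_le_sum (f := fun y => (τ x y - v.turnout x y) ^ 2)
          (fun y _ => sq_nonneg _) (Finset.mem_erase.2 ⟨hxy, Finset.mem_univ y⟩)
      have h2 : |τ x y - v.turnout x y| ≤ phi v τ₀ + 1 := by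
        apply abs_le_of_sq_le_sq' _ (by linarith) |> abs_le.2
        have : phi v τ ≤ phi v τ₀ := hle
        nlinarith
      have h3 := abs_sub_abs_le_abs_sub (τ x y) (v.turnout x y)
      linarith
  obtain ⟨τ, hτ, hmin⟩ := hcompact.exists_isMinOn ⟨τ₀, h₀, le_refl (phi v τ₀)⟩ hcont.continuousOn
  refine ⟨τ, hτ.1, fun τ' hτ' => ?_⟩
  by_cases h : phi v τ' ≤ phi v τ₀
  · exact hmin ⟨hτ', h⟩
  · exact le_trans hτ.2 (le_of_not_ge h)

theorem le_indirectScore_iff (v : LlullMatrix I) {x y : I} (hxy : x ≠ y) (s : ℝ) :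
    s ≤ v.indirectScore x y ↔ Relation.TransGen (fun a b => a ≠ b ∧ s ≤ v.score a b) x y := by
  have hbdd : BddAbove {s | ∃ (n : ℕ) (p : ℕ → I), IsPath (n + 1) p x y ∧ s = v.pathScore n p} := by
    refine ⟨1, ?_⟩
    rintro s ⟨n, p, hp, rfl⟩
    exact (pathScore_mem v hp).2
  constructor
  · intro h
    have hfin : {s | ∃ (n : ℕ) (p : ℕ → I), IsPath (n + 1) p x y ∧
        s = v.pathScore n p}.Finite := by
      refine (Set.finite_range fun q : I × I => v.score q.1 q.2).subset ?_
      rintro s ⟨n, p, hp, rfl⟩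
      obtain ⟨i, -, hi⟩ := Finset.exists_mem_eq_inf' (Finset.nonempty_range_add_one (n := n))
        (fun i => v.score (p i) (p (i + 1)))
      exact ⟨(p i, p (i + 1)), hi.symm⟩
    have hne : {s | ∃ (n : ℕ) (p : ℕ → I), IsPath (n + 1) p x y ∧
        s = v.pathScore n p}.Nonempty := by
      refine ⟨_, 0, fun i => if i = 0 then x else y, ⟨by simp, by simp, ?_⟩, rfl⟩
      intro i hi
      obtain rfl : i = 0 := by omega
      simpa using hxy
    obtain ⟨n, p, hp, he⟩ := hne.csSup_mem hfin
    have hs : s ≤ v.pathScore n p := by rw [← he]; exact h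
    obtain ⟨hp0, hpn, hpp⟩ := hp
    rw [← hp0, ← hpn]
    have hstep : ∀ i < n + 1, p i ≠ p (i + 1) ∧ s ≤ v.score (p i) (p (i + 1)) := fun i hi =>
      ⟨hpp i hi, hs.trans (Finset.inf'_le _ (Finset.mem_range.2 hi))⟩
    have hk : ∀ k ≤ n, Relation.TransGen (fun a b => a ≠ b ∧ s ≤ v.score a b)
        (p 0) (p (k + 1)) := by
      intro k
      induction k with
      | zero => exact fun _ => Relation.TransGen.single (hstep 0 (Nat.succ_pos n))
      | succ k ih => exact fun h => (ih (by omega)).tail (hstep (k + 1) (by omega))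
    exact hk n le_rfl
  · intro h
    suffices H : ∀ y, Relation.TransGen (fun a b => a ≠ b ∧ s ≤ v.score a b) x y →
        ∃ (n : ℕ) (p : ℕ → I), IsPath (n + 1) p x y ∧ s ≤ v.pathScore n p by
      obtain ⟨n, p, hp, hs⟩ := H y h
      exact hs.trans (le_csSup hbdd ⟨n, p, hp, rfl⟩)
    intro y h
    induction h with
    | single h =>
      rename_i b
      refine ⟨0, fun i => if i = 0 then x else b, ⟨by simp, by simp, ?_⟩, ?_⟩
      · intro i hi
        obtain rfl : i = 0 := by omega
        simpa using h.1
      · refine Finset.le_inf' _ _ fun i hi => ?_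
        obtain rfl : i = 0 := by simpa using hi
        simpa using h.2
    | tail _ h ih =>
      rename_i b c _
      obtain ⟨n, p, ⟨h0, hn, hp⟩, hs⟩ := ih
      refine ⟨n + 1, fun i => if i ≤ n + 1 then p i else c, ⟨by simpa using h0, by simp, ?_⟩, ?_⟩
      · intro i hi
        rcases Nat.lt_succ_iff_lt_or_eq.1 hi with hi | rfl
        · simpa [hi.le, Nat.succ_le_of_lt hi] using hp i hi
        · simpa [hn] using h.1
      · refine Finset.le_inf' _ _ fun i hi => ?_
        rcases Nat.lt_succ_iff_lt_or_eq.1 (Finset.mem_range.1 hi) with hi | rfl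
        · simpa [hi.le, Nat.succ_le_of_lt hi] using
            hs.trans (Finset.inf'_le _ (Finset.mem_range.2 hi))
        · simpa [hn] using h.2

theorem min_le_indirectScore (v : LlullMatrix I) {x y z : I} (hxy : x ≠ y) (hyz : y ≠ z)
    (hxz : x ≠ z) : min (v.indirectScore x y) (v.indirectScore y z) ≤ v.indirectScore x z := by
  rw [le_indirectScore_iff v hxz]
  exact ((le_indirectScore_iff v hxy _).1 (min_le_left _ _)).trans
    ((le_indirectScore_iff v hyz _).1 (min_le_right _ _))

theorem indirectComparison_trans (v : LlullMatrix I) {x y z : I}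
    (h₁ : v.indirectComparison x y) (h₂ : v.indirectComparison y z) :
    v.indirectComparison x z := by
  simp only [LlullMatrix.indirectComparison, LlullMatrix.indirectMargin, sub_pos] at *
  have hxy : x ≠ y := by rintro rfl; exact lt_irrefl _ h₁
  have hyz : y ≠ z := by rintro rfl; exact lt_irrefl _ h₂
  have hxz : x ≠ z := by rintro rfl; exact lt_asymm h₁ h₂
  have a := min_le_indirectScore v hxy hyz hxz
  have b := min_le_indirectScore v hyz hxz.symm hxy.symm
  have c := min_le_indirectScore v hxz.symm hxy hyz.symm
  have d := min_le_indirectScore v hxy.symm hxz hyz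
  by_contra hcon
  grind

theorem nonempty_admissibleOrder (v : LlullMatrix I) : Nonempty (AdmissibleOrder v) := by
  have hirr : ∀ x, ¬ v.indirectComparison x x := fun x h => by
    simp [LlullMatrix.indirectComparison, LlullMatrix.indirectMargin] at h
  have hpo : IsPartialOrder I (fun x y => x = y ∨ v.indirectComparison x y) :=
    { refl := fun x => Or.inl rfl
      trans := by
        rintro x y z (rfl | h) (rfl | h')
        · exact Or.inl rfl
        · exact Or.inr h'
        · exact Or.inr h
        · exact Or.inr (indirectComparison_trans v h h')
      antisymm := by
        rintro x y (rfl | h) (h' | h')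
        · rfl
        · rfl
        · exact h'.symm
        · exact absurd (indirectComparison_trans v h h') (hirr x) }
  obtain ⟨s, hs, hle⟩ := extend_partialOrder (fun x y => x = y ∨ v.indirectComparison x y)
  refine ⟨⟨fun x y => s x y ∧ x ≠ y, ?_, ?_⟩⟩
  · exact
      { trichotomous := fun x y h1 h2 => by
          by_contra hne
          rcases hs.total x y with h | h
          · exact h1 ⟨h, hne⟩
          · exact h2 ⟨h, Ne.symm hne⟩
        irrefl := fun x h => h.2 rfl
        trans := fun x y z h h' => ⟨hs.trans _ _ _ h.1 h'.1, by
          rintro rfl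
          exact h.2 (hs.antisymm _ _ h.1 h'.1)⟩ }
  · intro x y h
    exact ⟨hle x y (Or.inr h), by rintro rfl; exact hirr x h⟩

/-- The intermediate projected turnouts: the minimizer of `phi` over `feasible ξ`. -/
noncomputable def interTurnout {v : LlullMatrix I} (ξ : AdmissibleOrder v) : I → I → ℝ :=
  (exists_minimizer ξ).choose

/-- The elementary intervals, for `p'` the immediate successor of `p`. -/
noncomputable def gammaSucc {v : LlullMatrix I} (ξ : AdmissibleOrder v) (p p' : I) : Set ℝ :=
  Set.Icc ((interTurnout ξ p p' - interMargin ξ p p') / 2)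
    ((interTurnout ξ p p' + interMargin ξ p p') / 2)

/-- The intervals `γ x y`, for `x` before `y`: the union of the elementary intervals from `p` to
its successor `p'`, with `p` weakly after `x` and strictly before `y`. -/
def gamma {v : LlullMatrix I} (ξ : AdmissibleOrder v) (x y : I) : Set ℝ :=
  {s | ∃ p p', ξ.IsSucc p p' ∧ ξ.le x p ∧ ξ.lt p y ∧ s ∈ gammaSucc ξ p p'}

open Classical in
/-- The projected scores: the upper end of `γ x y` if `x` is before `y`, and the lower end
of `γ y x` if `y` is before `x`. -/
noncomputable def projScore {v : LlullMatrix I} (ξ : AdmissibleOrder v) (x y : I) : ℝ :=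
  if ξ.lt x y then sSup (gamma ξ x y) else sInf (gamma ξ y x)

/-- The rank-like rates. -/
noncomputable def rankLikeRate {v : LlullMatrix I} (ξ : AdmissibleOrder v) (x : I) : ℝ :=
  Fintype.card I - ∑ y ∈ Finset.univ.erase x, projScore ξ x y

/-- The total preorder determined by the rank-like rates, as a relation between different
options. -/
def ratePreorder {v : LlullMatrix I} (ξ : AdmissibleOrder v) (x y : I) : Prop :=
  x ≠ y ∧ rankLikeRate ξ x ≤ rankLikeRate ξ y

end Method

section Clones

variable {I : Type*}

/-- `C` is autonomous for the relation `ρ`. -/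
def IsAutonomousRel (C : Finset I) (ρ : I → I → Prop) : Prop :=
  ∀ x ∉ C, (∀ a ∈ C, ρ a x → ∀ b ∈ C, ρ b x) ∧ (∀ a ∈ C, ρ x a → ∀ b ∈ C, ρ x b)

/-- `C` is autonomous for the Llull matrix `v`. -/
def LlullMatrix.IsAutonomous (v : LlullMatrix I) (C : Finset I) : Prop :=
  ∀ a ∈ C, ∀ b ∈ C, ∀ x ∉ C, v.score a x = v.score b x ∧ v.score x a = v.score x b

/-- The set of options after contracting `C` to the single option `none`. -/
abbrev Contracted (C : Finset I) : Type _ := Option {x : I // x ∉ C}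

/-- The option of `I` that stands for an option of the contracted set, the new option being
represented by the element `a` of `C`. -/
def representative (C : Finset I) (a : I) : Contracted C → I
  | none => a
  | some x => x

theorem representative_injective {C : Finset I} {a : I} (ha : a ∈ C) :
    Function.Injective (representative C a) := by
  rintro (_ | x) (_ | y) h
  · rfl
  · exact absurd (show (y : I) ∈ C from (show a = y from h) ▸ ha) y.2
  · exact absurd (show (x : I) ∈ C from (show (x : I) = a from h) ▸ ha) x.2
  · exact congrArg some (Subtype.ext h)

/-- The contraction of a relation. It does not depend on `a ∈ C` when `C` is autonomous, except
for the irrelevant pair `none none`. -/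
def contractRel (C : Finset I) (a : I) (ρ : I → I → Prop) : Contracted C → Contracted C → Prop :=
  fun p q => ρ (representative C a p) (representative C a q)

/-- The contraction of a Llull matrix. It does not depend on `a ∈ C` when `C` is autonomous, except
for the meaningless diagonal entry `none none`. -/
def LlullMatrix.contract (v : LlullMatrix I) (C : Finset I) (a : I) (ha : a ∈ C) :
    LlullMatrix (Contracted C) where
  score p q := v.score (representative C a p) (representative C a q)
  score_nonneg _ _ h := v.score_nonneg _ _ ((representative_injective ha).ne h)
  turnout_le_one _ _ h := v.turnout_le_one _ _ ((representative_injective ha).ne h)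

end Clones

end CLC

/-! The rates enter the theorem only through their order, and that order depends on `ν` alone. By
`rankLikeRate_lt_iff`, `R_x < R_y` holds exactly when some set `T` containing `x` but not `y` has
all its members defeat, in the sense of `ν`, all options outside it. Neither the admissible order
nor the turnouts occur in this criterion. It holds because, along `ξ`, the rate increases from `x`
to its successor `x'` by at least `m^σ_{xx'}`, and stays constant when `m^σ_{xx'} = 0`
(`interMargin_le_rankLikeRate_sub`, `rankLikeRate_eq_of_isSucc`). So a strict increase occurs
exactly at a cut of `ξ` with positive margin, that is, where everything before the cut defeats
everything after it. Of the minimizer only its feasibility matters. For `ν`, paths are projected to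
the contracted set and lifted back, so indirect scores between options with different images are
preserved (`indirectScore_contract`). The claims on `R̂` then follow by transforming the separating
sets `T`. -/

namespace CLC

/-! ### Indirect scores under contraction -/

section Indirect

variable {I : Type*}

theorem not_indirectComparison_self (v : LlullMatrix I) (x : I) : ¬ v.indirectComparison x x := by
  simp [LlullMatrix.indirectComparison, LlullMatrix.indirectMargin]

open Classical in
/-- The image of an option in the contracted set. -/
noncomputable def toContracted (C : Finset I) (x : I) : Contracted C :=
  if h : x ∈ C then none else some ⟨x, h⟩

theorem toContracted_of_mem {C : Finset I} {x : I} (h : x ∈ C) : toContracted C x = none :=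
  dif_pos h

theorem toContracted_of_notMem {C : Finset I} {x : I} (h : x ∉ C) :
    toContracted C x = some ⟨x, h⟩ :=
  dif_neg h

theorem toContracted_representative {C : Finset I} {a : I} (ha : a ∈ C) (p : Contracted C) :
    toContracted C (representative C a p) = p := by
  rcases p with _ | x
  · exact toContracted_of_mem ha
  · exact toContracted_of_notMem x.2

/-- Autonomy permits exchanging an endpoint in `C` for `a`. Distinct images exclude links inside
`C`, whose scores autonomy does not control. -/
theorem score_representative_toContracted {v : LlullMatrix I} {C : Finset I}
    (hC : v.IsAutonomous C) {a : I} (ha : a ∈ C) {x y : I}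
    (h : toContracted C x ≠ toContracted C y) :
    v.score (representative C a (toContracted C x)) (representative C a (toContracted C y)) =
      v.score x y := by
  by_cases hx : x ∈ C <;> by_cases hy : y ∈ C
  · exact absurd ((toContracted_of_mem hx).trans (toContracted_of_mem hy).symm) h
  · rw [toContracted_of_mem hx, toContracted_of_notMem hy]
    exact (hC a ha x hx y hy).1
  · rw [toContracted_of_notMem hx, toContracted_of_mem hy]
    exact (hC a ha y hy x hx).2
  · rw [toContracted_of_notMem hx, toContracted_of_notMem hy]
    rfl

variable [Fintype I] [DecidableEq I]

theorem indirectScore_contract {v : LlullMatrix I} {C : Finset I}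
    (hC : v.IsAutonomous C) {a : I} (ha : a ∈ C) {x y : I}
    (h : toContracted C x ≠ toContracted C y) :
    (v.contract C a ha).indirectScore (toContracted C x) (toContracted C y) =
      v.indirectScore x y := by
  have hxy : x ≠ y := fun e => h (congrArg _ e)
  refine eq_of_forall_le_iff fun s => ?_
  rw [le_indirectScore_iff _ h, le_indirectScore_iff _ hxy]
  constructor
  · intro H
    -- A path of contracted options lifts to any prescribed preimages of its endpoints.
    have key : ∀ p q, Relation.TransGen
        (fun p q => p ≠ q ∧ s ≤ (v.contract C a ha).score p q) p q →
        ∀ x y, toContracted C x = p → toContracted C y = q →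
          Relation.TransGen (fun a b => a ≠ b ∧ s ≤ v.score a b) x y := by
      intro p q H
      have step : ∀ p q, p ≠ q ∧ s ≤ (v.contract C a ha).score p q →
          ∀ x y, toContracted C x = p → toContracted C y = q → x ≠ y ∧ s ≤ v.score x y := by
        rintro _ _ ⟨hne, hs⟩ x y rfl rfl
        exact ⟨fun e => hne (congrArg _ e), hs.trans_eq (score_representative_toContracted hC ha hne)⟩
      induction H with
      | single h1 => exact fun x y hx hy => .single (step _ _ h1 x y hx hy)
      | tail _ h1 ih =>
        rename_i b c _
        exact fun x y hx hy => (ih x (representative C a b) hx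
          (toContracted_representative ha b)).tail
            (step _ _ h1 _ y (toContracted_representative ha b) hy)
    exact key _ _ H x y rfl rfl
  · intro H
    -- A link inside `C` collapses to a point, so projection yields at first only a possibly empty
    -- path; it is nonempty because the endpoints have different images.
    have H' : Relation.ReflTransGen (fun p q => p ≠ q ∧ s ≤ (v.contract C a ha).score p q)
        (toContracted C x) (toContracted C y) := by
      refine Relation.ReflTransGen.lift' (toContracted C) (fun b c hbc => ?_) _ _
        H.to_reflTransGen
      by_cases hne : toContracted C b = toContracted C c
      · rw [Function.onFun, hne]
      · exact .single ⟨hne, hbc.2.trans_eq (score_representative_toContracted hC ha hne).symm⟩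
    exact (Relation.reflTransGen_iff_eq_or_transGen.1 H').resolve_left (Ne.symm h)

theorem indirectComparison_contract_toContracted {v : LlullMatrix I} {C : Finset I}
    (hC : v.IsAutonomous C) {a : I} (ha : a ∈ C) {x y : I}
    (h : toContracted C x ≠ toContracted C y) :
    (v.contract C a ha).indirectComparison (toContracted C x) (toContracted C y) ↔
      v.indirectComparison x y := by
  simp only [LlullMatrix.indirectComparison, LlullMatrix.indirectMargin,
    indirectScore_contract hC ha h, indirectScore_contract hC ha h.symm]

theorem indirectComparison_contract {v : LlullMatrix I} {C : Finset I}
    (hC : v.IsAutonomous C) {a : I} (ha : a ∈ C) :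
    (v.contract C a ha).indirectComparison = contractRel C a v.indirectComparison := by
  funext p q
  by_cases hpq : p = q
  · subst hpq
    exact propext ⟨fun h => absurd h (not_indirectComparison_self _ _),
      fun h => absurd h (not_indirectComparison_self _ _)⟩
  · have h := indirectComparison_contract_toContracted hC ha
      (x := representative C a p) (y := representative C a q)
    simp only [toContracted_representative ha] at h
    exact propext (h hpq)

/-- Two members of `C` have the same image in the contraction, where their comparisons with `x`
become one and the same. -/
theorem isAutonomousRel_indirectComparison {v : LlullMatrix I} {C : Finset I}
    (hC : v.IsAutonomous C) : IsAutonomousRel C v.indirectComparison := by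
  intro x hx
  have hne : ∀ a ∈ C, toContracted C a ≠ toContracted C x := fun a ha => by
    rw [toContracted_of_mem ha, toContracted_of_notMem hx]
    exact Option.some_ne_none _ |>.symm
  have heq : ∀ a ∈ C, ∀ b ∈ C, toContracted C a = toContracted C b := fun a ha b hb =>
    (toContracted_of_mem ha).trans (toContracted_of_mem hb).symm
  constructor
  · intro a ha h b hb
    rw [← indirectComparison_contract_toContracted hC ha (hne b hb), heq b hb a ha]
    exact (indirectComparison_contract_toContracted hC ha (hne a ha)).2 h
  · intro a ha h b hb
    rw [← indirectComparison_contract_toContracted hC ha (hne b hb).symm, heq b hb a ha]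
    exact (indirectComparison_contract_toContracted hC ha (hne a ha).symm).2 h

end Indirect

/-! ### Admissible orders and immediate successors -/

namespace AdmissibleOrder

variable {I : Type*} {v : LlullMatrix I} (ξ : AdmissibleOrder v)

theorem lt_irrefl (x : I) : ¬ ξ.lt x x := ξ.isStrictTotalOrder.irrefl x

variable {ξ}

theorem lt_trans {x y z : I} (h : ξ.lt x y) (h' : ξ.lt y z) : ξ.lt x z :=
  ξ.isStrictTotalOrder.trans x y z h h'

theorem lt_asymm {x y : I} (h : ξ.lt x y) : ¬ ξ.lt y x := fun h' => ξ.lt_irrefl x (lt_trans h h')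

theorem ne_of_lt {x y : I} (h : ξ.lt x y) : x ≠ y := by
  rintro rfl
  exact ξ.lt_irrefl x h

theorem le_of_not_lt {x y : I} (h : ¬ ξ.lt x y) : ξ.le y x := by
  by_contra hcon
  exact hcon (Or.inl (ξ.isStrictTotalOrder.trichotomous x y h fun h' => hcon (Or.inr h')).symm)

theorem lt_of_le_of_lt {x y z : I} (h : ξ.le x y) (h' : ξ.lt y z) : ξ.lt x z := by
  rcases h with rfl | h
  · exact h'
  · exact lt_trans h h'

theorem lt_of_lt_of_le {x y z : I} (h : ξ.lt x y) (h' : ξ.le y z) : ξ.lt x z := by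
  rcases h' with rfl | h'
  · exact h
  · exact lt_trans h h'

theorem le_trans {x y z : I} (h : ξ.le x y) (h' : ξ.le y z) : ξ.le x z := by
  rcases h with rfl | h
  · exact h'
  · exact Or.inr (lt_of_lt_of_le h h')

theorem not_lt_of_le {x y : I} (h : ξ.le x y) : ¬ ξ.lt y x := fun h' =>
  ξ.lt_irrefl x (lt_of_le_of_lt h h')

theorem IsSucc.le_of_lt {x x' y : I} (h : ξ.IsSucc x x') (hy : ξ.lt x y) : ξ.le x' y :=
  le_of_not_lt fun h' => h.2 y ⟨hy, h'⟩

theorem IsSucc.le_of_lt_succ {x x' y : I} (h : ξ.IsSucc x x') (hy : ξ.lt y x') : ξ.le y x :=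
  le_of_not_lt fun h' => h.2 y ⟨h', hy⟩

theorem IsSucc.unique {x x' x'' : I} (h : ξ.IsSucc x x') (h' : ξ.IsSucc x x'') : x' = x'' := by
  rcases h.le_of_lt h'.1 with e | e
  · exact e
  · exact absurd ⟨h.1, e⟩ (h'.2 x')

section Finite

variable [Finite I]

theorem wellFounded_lt (ξ : AdmissibleOrder v) : WellFounded ξ.lt :=
  have := ξ.isStrictTotalOrder
  Finite.wellFounded_of_trans_of_irrefl ξ.lt

/-- Supports inductions in which the claim is known for all later options, and the choice of the
last element of a nonempty set. -/
theorem wellFounded_gt (ξ : AdmissibleOrder v) : WellFounded fun x y => ξ.lt y x :=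
  have : Std.Irrefl fun x y => ξ.lt y x := ⟨ξ.lt_irrefl⟩
  have : IsTrans I fun x y => ξ.lt y x := ⟨fun _ _ _ h h' => lt_trans h' h⟩
  Finite.wellFounded_of_trans_of_irrefl _

theorem exists_isSucc {x y : I} (h : ξ.lt x y) : ∃ x', ξ.IsSucc x x' ∧ ξ.le x' y := by
  obtain ⟨m, hm, hmin⟩ := ξ.wellFounded_lt.has_min {z | ξ.lt x z} ⟨y, h⟩
  exact ⟨m, ⟨hm, fun z hz => hmin z hz.1 hz.2⟩, le_of_not_lt (hmin y h)⟩

theorem exists_isSucc_left {x y : I} (h : ξ.lt x y) : ∃ w, ξ.IsSucc w y ∧ ξ.le x w := by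
  obtain ⟨m, hm, hmin⟩ := ξ.wellFounded_gt.has_min {z | ξ.lt z y} ⟨x, h⟩
  exact ⟨m, ⟨hm, fun z hz => hmin z hz.2 hz.1⟩, le_of_not_lt (hmin x h)⟩

end Finite

end AdmissibleOrder

/-! ### Rates along an admissible order -/

section Rates

open AdmissibleOrder

variable {I : Type*} [Fintype I] [DecidableEq I] {v : LlullMatrix I} {ξ : AdmissibleOrder v}

theorem interTurnout_mem_feasible (ξ : AdmissibleOrder v) : interTurnout ξ ∈ feasible ξ :=
  (exists_minimizer ξ).choose_spec.1

omit [DecidableEq I] in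
-- The bridge from real quantities to `ν`: a minimum over a finite set is positive exactly when all
-- its entries are.
theorem interMargin_pos_iff {x y : I} :
    0 < interMargin ξ x y ↔ ∀ p q, ξ.le p x → ξ.le y q → v.indirectComparison p q := by
  classical
  refine (Finset.lt_inf'_iff _).trans ⟨fun h p q hp hq => ?_, fun h pq hpq => ?_⟩
  · exact h (p, q) (Finset.mem_filter.2 ⟨Finset.mem_univ _, hp, hq⟩)
  · exact h _ _ (Finset.mem_filter.1 hpq).2.1 (Finset.mem_filter.1 hpq).2.2

theorem gammaSucc_nonempty {x x' : I} (h : ξ.lt x x') : (gammaSucc ξ x x').Nonempty :=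
  Set.nonempty_Icc.2 (by linarith [interMargin_nonneg ξ h])

theorem gammaSucc_subset_gamma {x y p p' : I} (h : ξ.IsSucc p p') (hx : ξ.le x p)
    (hy : ξ.lt p y) : gammaSucc ξ p p' ⊆ gamma ξ x y :=
  fun _ hs => ⟨p, p', h, hx, hy, hs⟩

theorem gamma_nonempty {x y : I} (h : ξ.lt x y) : (gamma ξ x y).Nonempty := by
  obtain ⟨x', hx', -⟩ := exists_isSucc h
  exact (gammaSucc_nonempty hx'.1).mono (gammaSucc_subset_gamma hx' (Or.inl rfl) h)

theorem gamma_subset_iUnion (x y : I) :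
    gamma ξ x y ⊆ ⋃ p, ⋃ p', gammaSucc ξ p p' := by
  rintro s ⟨p, p', -, -, -, hs⟩
  exact Set.mem_iUnion₂.2 ⟨p, p', hs⟩

theorem gamma_isBounded (x y : I) : Bornology.IsBounded (gamma ξ x y) :=
  ((Bornology.isBounded_iUnion.2 fun _ => Bornology.isBounded_iUnion.2 fun _ =>
    Metric.isBounded_Icc _ _ : Bornology.IsBounded (⋃ p, ⋃ p', gammaSucc ξ p p'))).subset
      (gamma_subset_iUnion x y)

theorem gamma_isSucc {x x' : I} (h : ξ.IsSucc x x') : gamma ξ x x' = gammaSucc ξ x x' := by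
  refine Set.Subset.antisymm ?_ (gammaSucc_subset_gamma h (Or.inl rfl) h.1)
  rintro s ⟨p, p', hp, hxp, hpx, hs⟩
  have e : x = p := hxp.resolve_right fun h' => h.2 p ⟨h', hpx⟩
  subst e
  rwa [h.unique hp]

theorem gamma_mono {x y z w : I} (hx : ξ.le x z) (hy : ξ.le w y) : gamma ξ z w ⊆ gamma ξ x y := by
  rintro s ⟨p, p', hp, h1, h2, hs⟩
  exact ⟨p, p', hp, le_trans hx h1, lt_of_lt_of_le h2 hy, hs⟩

theorem gamma_eq_union_left {x x' z : I} (h : ξ.IsSucc x x') (hz : ξ.lt x' z) :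
    gamma ξ x z = gammaSucc ξ x x' ∪ gamma ξ x' z := by
  refine Set.Subset.antisymm ?_ (Set.union_subset
    (gammaSucc_subset_gamma h (Or.inl rfl) (lt_trans h.1 hz))
    (gamma_mono (Or.inr h.1) (Or.inl rfl)))
  rintro s ⟨p, p', hp, hxp | hxp, hpz, hs⟩
  · subst hxp
    rw [h.unique hp]
    exact Or.inl hs
  · exact Or.inr ⟨p, p', hp, h.le_of_lt hxp, hpz, hs⟩

theorem gamma_eq_union_right {x x' z : I} (h : ξ.IsSucc x x') (hz : ξ.lt z x) :
    gamma ξ z x' = gamma ξ z x ∪ gammaSucc ξ x x' := by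
  refine Set.Subset.antisymm ?_ (Set.union_subset
    (gamma_mono (Or.inl rfl) (Or.inr h.1))
    (gammaSucc_subset_gamma h (Or.inr hz) h.1))
  rintro s ⟨p, p', hp, hzp, hpx, hs⟩
  rcases h.le_of_lt_succ hpx with e | hlt
  · subst e
    rw [h.unique hp]
    exact Or.inr hs
  · exact Or.inl ⟨p, p', hp, hzp, hlt, hs⟩

theorem projScore_of_lt {x y : I} (h : ξ.lt x y) : projScore ξ x y = sSup (gamma ξ x y) :=
  if_pos h

theorem projScore_of_gt {x y : I} (h : ξ.lt x y) : projScore ξ y x = sInf (gamma ξ x y) :=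
  if_neg (lt_asymm h)

theorem projScore_sub_of_isSucc {x x' : I} (h : ξ.IsSucc x x') :
    projScore ξ x x' - projScore ξ x' x = interMargin ξ x x' := by
  have hm := interMargin_nonneg ξ h.1
  rw [projScore_of_lt h.1, projScore_of_gt h.1, gamma_isSucc h, gammaSucc,
    csSup_Icc (by linarith), csInf_Icc (by linarith)]
  ring

/-- Moving from `x` to `x'` shrinks the `γ` interval towards a later `z`, which cannot raise its
supremum, and enlarges the one from an earlier `z`, which cannot raise its infimum. -/
theorem projScore_le_of_isSucc {x x' z : I} (h : ξ.IsSucc x x') (hz : z ≠ x) (hz' : z ≠ x') :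
    projScore ξ x' z ≤ projScore ξ x z := by
  by_cases hlt : ξ.lt x z
  · have h' : ξ.lt x' z := (h.le_of_lt hlt).resolve_left hz'.symm
    rw [projScore_of_lt hlt, projScore_of_lt h']
    exact csSup_le_csSup (gamma_isBounded _ _).bddAbove (gamma_nonempty h')
      (gamma_mono (Or.inr h.1) (Or.inl rfl))
  · have h' : ξ.lt z x := (le_of_not_lt hlt).resolve_left hz
    rw [projScore_of_gt h', projScore_of_gt (lt_trans h' h.1)]
    exact csInf_le_csInf (gamma_isBounded _ _).bddBelow (gamma_nonempty h')
      (gamma_mono (Or.inl rfl) (Or.inr h.1))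

/-- With zero margin `γ_{xx'}` is the single point `t^σ_{xx'}/2`, and feasibility places it inside
the adjacent elementary interval on the side of `z`. Adding it to the union changes nothing. -/
theorem projScore_eq_of_isSucc {x x' z : I} (h : ξ.IsSucc x x') (h0 : interMargin ξ x x' = 0)
    (hz : z ≠ x) (hz' : z ≠ x') : projScore ξ x z = projScore ξ x' z := by
  obtain ⟨-, hsymm, -, hdiff⟩ := interTurnout_mem_feasible ξ
  by_cases hlt : ξ.lt x z
  · have h' : ξ.lt x' z := (h.le_of_lt hlt).resolve_left hz'.symm
    rw [projScore_of_lt hlt, projScore_of_lt h', gamma_eq_union_left h h', Set.union_eq_right.2]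
    obtain ⟨x'', hs, -⟩ := exists_isSucc h'
    refine Set.Subset.trans ?_ (gammaSucc_subset_gamma hs (Or.inl rfl) h')
    have hx := lt_trans h.1 hs.1
    -- These give `t_{xx''} = t_{x'x''}` and `0 ≤ t_{xx'} - t_{xx''} ≤ m_{x'x''}`, so the point lies
    -- in the upper half of `γ_{x'x''}`.
    have h1 := hdiff x x' x'' h (ne_of_lt hx).symm (ne_of_lt hs.1).symm
    have h2 := hdiff x' x'' x hs (ne_of_lt h.1) (ne_of_lt hx)
    rw [hsymm x' x, hsymm x'' x] at h2
    exact Set.Icc_subset_Icc (by linarith) (by linarith)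
  · have h' : ξ.lt z x := (le_of_not_lt hlt).resolve_left hz
    rw [projScore_of_gt h', projScore_of_gt (lt_trans h' h.1), gamma_eq_union_right h h',
      Set.union_eq_left.2]
    obtain ⟨w, hs, hw⟩ := exists_isSucc_left h'
    refine Set.Subset.trans ?_ (gammaSucc_subset_gamma hs hw hs.1)
    have hx := lt_trans hs.1 h.1
    -- Mirror image: `t_{wx} = t_{wx'}` and `0 ≤ t_{wx'} - t_{xx'} ≤ m_{wx}`, so the point lies in
    -- the lower half of `γ_{wx}`.
    have h1 := hdiff x x' w h (ne_of_lt hs.1) (ne_of_lt hx)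
    have h2 := hdiff w x x' hs (ne_of_lt hx).symm (ne_of_lt h.1).symm
    rw [hsymm x w, hsymm x' w] at h1
    exact Set.Icc_subset_Icc (by linarith) (by linarith)

/-- The constant `N` cancels, and the two scores comparing `x` and `x'` with each other contribute
exactly their margin. -/
theorem rankLikeRate_sub_of_isSucc {x x' : I} (h : ξ.IsSucc x x') :
    rankLikeRate ξ x' - rankLikeRate ξ x = interMargin ξ x x' +
      ∑ z ∈ (Finset.univ.erase x).erase x', (projScore ξ x z - projScore ξ x' z) := by
  have hne := ne_of_lt h.1
  have h1 := Finset.add_sum_erase (Finset.univ.erase x) (projScore ξ x)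
    (Finset.mem_erase.2 ⟨hne.symm, Finset.mem_univ x'⟩)
  have h2 := Finset.add_sum_erase (Finset.univ.erase x') (projScore ξ x')
    (Finset.mem_erase.2 ⟨hne, Finset.mem_univ x⟩)
  rw [Finset.erase_right_comm] at h2
  rw [Finset.sum_sub_distrib, ← projScore_sub_of_isSucc h, rankLikeRate, rankLikeRate, ← h1, ← h2]
  ring

theorem interMargin_le_rankLikeRate_sub {x x' : I} (h : ξ.IsSucc x x') :
    interMargin ξ x x' ≤ rankLikeRate ξ x' - rankLikeRate ξ x := by
  rw [rankLikeRate_sub_of_isSucc h]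
  refine le_add_of_nonneg_right (Finset.sum_nonneg fun z hz => ?_)
  simp only [Finset.mem_erase] at hz
  exact sub_nonneg.2 (projScore_le_of_isSucc h hz.2.1 hz.1)

theorem rankLikeRate_eq_of_isSucc {x x' : I} (h : ξ.IsSucc x x')
    (h0 : interMargin ξ x x' = 0) : rankLikeRate ξ x' = rankLikeRate ξ x := by
  rw [← sub_eq_zero, rankLikeRate_sub_of_isSucc h, h0, zero_add]
  refine Finset.sum_eq_zero fun z hz => ?_
  simp only [Finset.mem_erase] at hz
  exact sub_eq_zero.2 (projScore_eq_of_isSucc h h0 hz.2.1 hz.1)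

theorem rankLikeRate_mono {x y : I} (h : ξ.le x y) : rankLikeRate ξ x ≤ rankLikeRate ξ y := by
  induction x using ξ.wellFounded_gt.induction with
  | _ x ih =>
    rcases h with rfl | h
    · exact le_rfl
    · obtain ⟨x', hx', hy⟩ := exists_isSucc h
      have h1 := interMargin_le_rankLikeRate_sub hx'
      have h2 := interMargin_nonneg ξ hx'.1
      linarith [ih x' hx'.1 hy]

/-- If all elementary margins from `x` to `y` vanished, the rate would be constant between them. -/
theorem exists_interMargin_pos {x y : I} (h : ξ.le x y)
    (hR : rankLikeRate ξ x < rankLikeRate ξ y) :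
    ∃ p p', ξ.IsSucc p p' ∧ ξ.le x p ∧ ξ.lt p y ∧ 0 < interMargin ξ p p' := by
  induction x using ξ.wellFounded_gt.induction with
  | _ x ih =>
    rcases h with rfl | h
    · exact absurd hR (_root_.lt_irrefl _)
    · obtain ⟨x', hx', hy⟩ := exists_isSucc h
      rcases (interMargin_nonneg ξ hx'.1).eq_or_lt' with h0 | h0
      · rw [← rankLikeRate_eq_of_isSucc hx' h0] at hR
        obtain ⟨p, p', hp, hxp, hpy, hpos⟩ := ih x' hx'.1 hy hR
        exact ⟨p, p', hp, Or.inr (lt_of_lt_of_le hx'.1 hxp), hpy, hpos⟩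
      · exact ⟨x, x', hx', Or.inl rfl, h, h0⟩

/-- The strict part of the preorder of the rates consists of the pairs separated by a set of
options all of which defeat, in the indirect comparison, all the options outside it. -/
theorem rankLikeRate_lt_iff {x y : I} :
    rankLikeRate ξ x < rankLikeRate ξ y ↔
      ∃ T : Set I, x ∈ T ∧ y ∉ T ∧ ∀ p ∈ T, ∀ q ∉ T, v.indirectComparison p q := by
  constructor
  · intro hR
    have hlt : ξ.lt x y := by
      by_contra hcon
      exact absurd (rankLikeRate_mono (le_of_not_lt hcon)) hR.not_ge
    obtain ⟨p, p', hp, hxp, hpy, hpos⟩ := exists_interMargin_pos (Or.inr hlt) hR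
    -- The separating set is the initial segment of `ξ` that ends at the cut.
    refine ⟨{q | ξ.le q p}, hxp, fun h => not_lt_of_le h hpy, fun q hq r hr => ?_⟩
    exact interMargin_pos_iff.1 hpos q r hq (le_of_not_lt fun h => hr (hp.le_of_lt_succ h))
  · rintro ⟨T, hx, hy, hT⟩
    -- Let `p` be the last element of `T`. Since `ξ` extends `ν`, the set `T` is an initial segment,
    -- so the cut after `p` has positive margin and lies between `x` and `y`.
    obtain ⟨p, hp, hmax⟩ := ξ.wellFounded_gt.has_min T ⟨x, hx⟩
    obtain ⟨p', hp', hy'⟩ := exists_isSucc (ξ.extends_comparison p y (hT p hp y hy))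
    have hpos : 0 < interMargin ξ p p' := by
      refine interMargin_pos_iff.2 fun q r hq hr => hT q ?_ r ?_
      · by_contra hcon
        exact not_lt_of_le hq (ξ.extends_comparison p q (hT p hp q hcon))
      · exact fun hcon => hmax r hcon (lt_of_lt_of_le hp'.1 hr)
    have h1 := rankLikeRate_mono (le_of_not_lt (hmax x hx))
    have h2 := rankLikeRate_mono hy'
    linarith [interMargin_le_rankLikeRate_sub hp']

/-- A set separating `x` from one clone is modified so as to separate `x` from any other, by moving
all of `C` to one side. -/
theorem isAutonomousRel_ratePreorder {C : Finset I}
    (hν : IsAutonomousRel C v.indirectComparison) (ξ : AdmissibleOrder v) :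
    IsAutonomousRel C (ratePreorder ξ) := by
  intro x hx
  constructor
  · rintro a ha ⟨-, h⟩ b hb
    refine ⟨fun e => hx (e ▸ hb), le_of_not_gt fun hlt => h.not_gt ?_⟩
    obtain ⟨T, hxT, hbT, hT⟩ := rankLikeRate_lt_iff.1 hlt
    -- Members of `T \ C` defeat `b`, hence by autonomy all of `C`.
    refine rankLikeRate_lt_iff.2 ⟨T \ C, ⟨hxT, hx⟩, fun h => h.2 ha, fun p hp q hq => ?_⟩
    by_cases hqC : q ∈ C
    · exact (hν p hp.2).2 b hb (hT p hp.1 b hbT) q hqC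
    · exact hT p hp.1 q fun h => hq ⟨h, hqC⟩
  · rintro a ha ⟨-, h⟩ b hb
    refine ⟨fun e => hx (e ▸ hb), le_of_not_gt fun hlt => h.not_gt ?_⟩
    obtain ⟨T, hbT, hxT, hT⟩ := rankLikeRate_lt_iff.1 hlt
    -- Dually, `b` defeats everything outside `T`, hence all of `C` defeats everything outside `T ∪
    -- C`.
    refine rankLikeRate_lt_iff.2 ⟨T ∪ C, Or.inr ha, fun h => h.elim hxT hx, fun p hp q hq => ?_⟩
    have hqT : q ∉ T := fun h => hq (Or.inl h)
    have hqC : q ∉ C := fun h => hq (Or.inr h)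
    rcases hp with hp | hp
    · exact hT p hp q hqT
    · exact (hν q hqC).1 b hb (hT b hbT q hqT) p hp

/-- Separating sets pull back along `toContracted` and along `representative`, which gives the two
directions. The orders `ξ` and `ξ'` need not be related, since the criterion mentions neither. -/
theorem ratePreorder_contract {C : Finset I} (hC : v.IsAutonomous C) {a : I} (ha : a ∈ C)
    (ξ : AdmissibleOrder v) (ξ' : AdmissibleOrder (v.contract C a ha)) :
    ratePreorder ξ' = contractRel C a (ratePreorder ξ) := by
  funext p q
  simp only [contractRel, ratePreorder, ← not_lt, (representative_injective ha).ne_iff]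
  rw [rankLikeRate_lt_iff, rankLikeRate_lt_iff]
  refine congrArg (fun P => p ≠ q ∧ ¬ P) (propext ⟨?_, ?_⟩)
  · rintro ⟨T, hq, hp, hT⟩
    refine ⟨toContracted C ⁻¹' T, ?_, ?_, fun r hr s hs => ?_⟩
    · rwa [Set.mem_preimage, toContracted_representative ha]
    · rwa [Set.mem_preimage, toContracted_representative ha]
    · exact (indirectComparison_contract_toContracted hC ha (fun e => hs (show _ ∈ T from e ▸ hr))).1
        (hT _ hr _ hs)
  · rintro ⟨T, hq, hp, hT⟩
    refine ⟨representative C a ⁻¹' T, hq, hp, fun r hr s hs => ?_⟩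
    rw [indirectComparison_contract hC ha]
    exact hT _ hr _ hs

end Rates

end CLC

theorem mainTheorem9 {I : Type*} [Fintype I] [DecidableEq I] (v : CLC.LlullMatrix I)
    (C : Finset I) (hC : v.IsAutonomous C) :
    CLC.IsAutonomousRel C v.indirectComparison ∧
    (∀ ξ : CLC.AdmissibleOrder v, CLC.IsAutonomousRel C (CLC.ratePreorder ξ)) ∧
    (∀ (a : I) (ha : a ∈ C),
      (v.contract C a ha).indirectComparison = CLC.contractRel C a v.indirectComparison ∧
      ∀ (ξ : CLC.AdmissibleOrder v) (ξ' : CLC.AdmissibleOrder (v.contract C a ha)),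
        CLC.ratePreorder ξ' = CLC.contractRel C a (CLC.ratePreorder ξ)) :=
  have hν := CLC.isAutonomousRel_indirectComparison hC
  ⟨hν, CLC.isAutonomousRel_ratePreorder hν, fun _ ha =>
    ⟨CLC.indirectComparison_contract hC ha, CLC.ratePreorder_contract hC ha⟩⟩
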